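/- Let $g\ge 4$ and $r\ge 3$ be integers. Let $G=(V,E)$ be a finite simple graph that is $r$-regular (every node has degree exactly $r$) and has girth at least $g$ (every cycle of $G$ has length at least $g$; $G$ need not be connected). Then $G$ has a matching $M$, that is, a set of edges such that every node is incident to at most one edge of $M$, with $$|M|\;\ge\;\left(\frac{1-(r-1)^{-\frac{r}{r-2}}}{2}\;-\;\frac{r\,(r-1)^{\lfloor (g-2)/2\rfloor}}{\lfloor (g-2)/2\rfloor\,!}\right)|V| .$$ -/

import Mathlib

open Finset

namespace SimpleGraph

/-! ### Matchings and odd barriers -/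

section Tutte

variable {V : Type*}

/-! Only triangle-freeness is needed from the girth. In an `r`-regular triangle-free graph, Mantel's
theorem makes every odd set `T` send out at least `r` edges or have at least `2r+1` vertices
(`boundary_or_card`). As `S` absorbs at most `r * #S` edges, an odd barrier satisfies `#𝒯 ≤ #S + a *
n` with `a = (r-1)^(-r/(r-2))` (`IsOddBarrier.card_le`). Tutte–Berge then gives a matching missing
at most `a * n` vertices. The factorial term is merely discarded. -/

theorem Subgraph.IsMatching.ncard_verts_le [Finite V] {G : SimpleGraph V} {M : G.Subgraph}
    (hM : M.IsMatching) : M.verts.ncard ≤ 2 * M.edgeSet.ncard := by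
  classical
  have := Fintype.ofFinite V
  have hsub : M.verts.toFinset ⊆ M.edgeSet.toFinset.biUnion Sym2.toFinset := by
    intro v hv
    obtain ⟨w, hw, -⟩ := hM (Set.mem_toFinset.1 hv)
    simp only [Finset.mem_biUnion, Set.mem_toFinset]
    exact ⟨s(v, w), hw, by simp⟩
  rw [Set.ncard_eq_toFinset_card', Set.ncard_eq_toFinset_card', mul_comm]
  refine (Finset.card_le_card hsub).trans (Finset.card_biUnion_le_card_mul _ _ _ fun e _ => ?_)
  rw [Sym2.card_toFinset]
  split_ifs <;> simp

/-- An odd barrier: the vertex sets in `𝒯` are odd, disjoint, and separated from each other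
by `S`. -/
structure IsOddBarrier (G : SimpleGraph V) (S : Finset V) (𝒯 : Finset (Finset V)) : Prop where
  odd : ∀ T ∈ 𝒯, Odd #T
  pairwiseDisjoint : (𝒯 : Set (Finset V)).PairwiseDisjoint id
  disjoint : ∀ T ∈ 𝒯, Disjoint T S
  closed : ∀ T ∈ 𝒯, ∀ v ∈ T, ∀ w, G.Adj v w → w ∈ T ∨ w ∈ S

theorem exists_isOddBarrier [Fintype V] {G : SimpleGraph V} (heven : Even (Fintype.card V))
    (h : ∀ M : G.Subgraph, ¬ M.IsPerfectMatching) :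
    ∃ S 𝒯, G.IsOddBarrier S 𝒯 ∧ #S + 2 ≤ #𝒯 := by
  classical
  obtain ⟨u, hu⟩ : ∃ u, G.IsTutteViolator u := by
    by_contra! hu
    obtain ⟨M, hM⟩ := tutte.2 hu
    exact h M hM
  set H := ((⊤ : G.Subgraph).deleteVerts u).coe with hH
  have hverts : ∀ x : ((⊤ : G.Subgraph).deleteVerts u).verts, (x : V) ∉ u := fun x => by
    have := x.2
    simp only [Subgraph.deleteVerts_verts, Set.mem_sdiff] at this
    exact this.2
  let F : H.ConnectedComponent → Finset V := fun c => (Subtype.val '' c.supp).toFinset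
  have hF : ∀ c v, v ∈ F c ↔ ∃ hv, H.connectedComponentMk ⟨v, hv⟩ = c := by
    intro c v
    simp [F]
  have hcard : ∀ c, #(F c) = c.supp.ncard := by
    intro c
    rw [← Set.ncard_eq_toFinset_card', Set.ncard_image_of_injective _ Subtype.val_injective]
  have hdisj : ∀ c c' v, v ∈ F c → v ∈ F c' → c = c' := by
    intro c c' v h1 h2
    obtain ⟨_, rfl⟩ := (hF _ _).1 h1
    obtain ⟨_, rfl⟩ := (hF _ _).1 h2
    rfl
  have hinj : Set.InjOn F H.oddComponents := by
    intro c hc c' _ hcc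
    have : 0 < #(F c) := by rw [hcard]; exact Odd.pos hc
    obtain ⟨v, hv⟩ := Finset.card_pos.1 this
    exact hdisj c c' v hv (hcc ▸ hv)
  have hk : #(H.oddComponents.toFinset.image F) = H.oddComponents.ncard := by
    rw [Finset.card_image_of_injOn (by simpa using hinj), Set.ncard_eq_toFinset_card']
  refine ⟨u.toFinset, H.oddComponents.toFinset.image F, ⟨?_, ?_, ?_, ?_⟩, ?_⟩
  · intro T hT
    obtain ⟨c, hc, rfl⟩ := Finset.mem_image.1 hT
    rw [hcard]
    simpa using hc
  · intro T hT T' hT' hne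
    obtain ⟨c, hc, rfl⟩ := Finset.mem_image.1 hT
    obtain ⟨c', hc', rfl⟩ := Finset.mem_image.1 hT'
    refine Finset.disjoint_left.2 fun v h1 h2 => hne ?_
    rw [hdisj c c' v h1 h2]
  · intro T hT
    obtain ⟨c, hc, rfl⟩ := Finset.mem_image.1 hT
    refine Finset.disjoint_left.2 fun v h1 h2 => ?_
    obtain ⟨hv, -⟩ := (hF _ _).1 h1
    exact hverts ⟨v, hv⟩ (by simpa using h2)
  · intro T hT v hv w hvw
    obtain ⟨c, hc, rfl⟩ := Finset.mem_image.1 hT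
    by_cases hw : w ∈ u
    · right; simpa using hw
    left
    obtain ⟨hv', rfl⟩ := (hF _ _).1 hv
    have hw' : w ∈ ((⊤ : G.Subgraph).deleteVerts u).verts := by simpa using hw
    refine (hF _ _).2 ⟨hw', ?_⟩
    refine ConnectedComponent.sound (Adj.reachable ?_)
    have := hverts ⟨v, hv'⟩
    simp only [hH, Subgraph.coe_adj, Subgraph.deleteVerts_adj]
    simp_all [hvw.symm]
  · rw [hk, ← Set.ncard_eq_toFinset_card']
    have hlt : u.ncard < H.oddComponents.ncard := hu
    -- Parity: as `V` is even, `#𝒯` and `#S` agree mod 2, so a strict excess is at least 2.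
    have hpar := odd_ncard_oddComponents (G := H)
    have hc : Nat.card ((⊤ : G.Subgraph).deleteVerts u).verts + u.ncard = Fintype.card V := by
      have := Set.ncard_add_ncard_compl u
      rw [Nat.card_coe_set_eq, Subgraph.deleteVerts_verts, Subgraph.verts_top,
        ← Set.compl_eq_univ_sdiff, add_comm, this, Nat.card_eq_fintype_card]
    rw [Nat.odd_iff, Nat.odd_iff] at hpar
    rw [Nat.even_iff] at heven
    omega

/-- The join of `G` with the complete graph on `W`. -/
def joinTop (G : SimpleGraph V) (W : Type*) : SimpleGraph (V ⊕ W) := (Gᶜ ⊕g (⊥ : SimpleGraph W))ᶜ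

theorem joinTop_adj_inl {G : SimpleGraph V} {W : Type*} {v w : V} :
    (G.joinTop W).Adj (.inl v) (.inl w) ↔ G.Adj v w := by
  simp only [joinTop, compl_adj, sum_adj_inl, ne_eq, Sum.inl.injEq]
  have := G.ne_of_adj (a := v) (b := w)
  tauto

theorem joinTop_adj_inr {G : SimpleGraph V} {W : Type*} {x : V ⊕ W} {w : W}
    (h : x ≠ .inr w) : (G.joinTop W).Adj x (.inr w) := by
  cases x <;> simp_all [joinTop]

/-- Vertices of `V` not matched inside `V` have distinct partners in `W`. -/
theorem exists_isMatching_of_joinTop [Fintype V] {G : SimpleGraph V} {W : Type*} [Fintype W]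
    {M : (G.joinTop W).Subgraph} (hM : M.IsPerfectMatching) :
    ∃ N : G.Subgraph, N.IsMatching ∧
      Fintype.card V ≤ 2 * N.edgeSet.ncard + Fintype.card W := by
  classical
  let N : G.Subgraph :=
    { verts := {v | ∃ w, M.Adj (.inl v) (.inl w)}
      Adj := fun v w => M.Adj (.inl v) (.inl w)
      adj_sub := fun h => joinTop_adj_inl.1 (M.adj_sub h)
      edge_vert := fun h => ⟨_, h⟩
      symm := ⟨fun _ _ h => Subgraph.Adj.symm h⟩ }
  have hN : N.IsMatching := by
    rintro v ⟨w, hw⟩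
    exact ⟨w, hw, fun y hy => Sum.inl_injective (hM.1.eq_of_adj_left hy hw)⟩
  refine ⟨N, hN, ?_⟩
  have hc : N.vertsᶜ.ncard ≤ Fintype.card W := by
    have hex : ∀ v : (N.vertsᶜ : Set V), ∃ w, M.Adj (.inl v.1) (.inr w) := by
      intro v
      obtain ⟨y, hy, -⟩ := Subgraph.isPerfectMatching_iff.1 hM (.inl v.1)
      cases y with
      | inl y => exact absurd ⟨y, hy⟩ v.2
      | inr y => exact ⟨y, hy⟩
    choose f hf using hex
    rw [← Nat.card_coe_set_eq, ← Nat.card_eq_fintype_card]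
    refine Nat.card_le_card_of_injective f fun a b hab => ?_
    have h1 := hf a
    rw [hab] at h1
    exact Subtype.ext (Sum.inl_injective (hM.1.eq_of_adj_right h1 (hf b)))
  have h1 := Set.ncard_add_ncard_compl N.verts
  have h2 := hN.ncard_verts_le
  rw [Nat.card_eq_fintype_card] at h1
  omega

/-- One direction of the Tutte–Berge formula. -/
theorem exists_isMatching_of_card_lt [Fintype V] {G : SimpleGraph V} {d : ℕ}
    (heven : Even (Fintype.card V + d))
    (h : ∀ S 𝒯, G.IsOddBarrier S 𝒯 → #𝒯 < #S + d + 2) :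
    ∃ M : G.Subgraph, M.IsMatching ∧ Fintype.card V ≤ 2 * M.edgeSet.ncard + d := by
  classical
  by_cases hM : ∃ M : (G.joinTop (Fin d)).Subgraph, M.IsPerfectMatching
  · obtain ⟨M, hM⟩ := hM
    simpa using exists_isMatching_of_joinTop hM
  exfalso
  push Not at hM
  obtain ⟨S, 𝒯, hb, hST⟩ := exists_isOddBarrier (by simpa using heven) hM
  have hne : ∀ T ∈ 𝒯, T.Nonempty := fun T hT => Finset.card_pos.1 (hb.odd T hT).pos
  -- An added vertex outside `S` is adjacent to everything, so it would lie in every `T`;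
  -- disjointness would leave at most one `T`.
  have hS : ∀ i, Sum.inr i ∈ S := by
    intro i
    by_contra hi
    have hmem : ∀ T ∈ 𝒯, Sum.inr i ∈ T := by
      intro T hT
      obtain ⟨v, hv⟩ := hne T hT
      by_cases hvi : v = .inr i
      · exact hvi ▸ hv
      · exact (hb.closed T hT v hv _ (joinTop_adj_inr hvi)).resolve_right hi
    have : #𝒯 ≤ 1 := Finset.card_le_one.2 fun T hT T' hT' => by
      by_contra hTT
      exact Finset.disjoint_left.1 (hb.pairwiseDisjoint hT hT' hTT) (hmem T hT) (hmem T' hT')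
    omega
  have hT : ∀ T ∈ 𝒯, T.toLeft.map .inl = T := by
    intro T hT
    ext x
    cases x with
    | inl x => simp
    | inr i => simpa using Finset.disjoint_right.1 (hb.disjoint T hT) (hS i)
  have hinj : Set.InjOn Finset.toLeft (𝒯 : Set (Finset (V ⊕ Fin d))) := by
    intro T h1 T' h2 h12
    rw [← hT T h1, ← hT T' h2, h12]
  have hcard : #S = #S.toLeft + d := by
    rw [← Finset.card_toLeft_add_card_toRight (u := S)]
    have : S.toRight = Finset.univ := by ext i; simp [hS i]
    simp [this]
  have := h S.toLeft (𝒯.image Finset.toLeft) ⟨?_, ?_, ?_, ?_⟩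
  · rw [Finset.card_image_of_injOn hinj] at this
    omega
  · intro T' hT'
    obtain ⟨T, hT1, rfl⟩ := Finset.mem_image.1 hT'
    have := hb.odd T hT1
    rwa [← hT T hT1, Finset.card_map] at this
  · intro T' hT' T'' hT'' hne
    obtain ⟨T1, hT1, rfl⟩ := Finset.mem_image.1 hT'
    obtain ⟨T2, hT2, rfl⟩ := Finset.mem_image.1 hT''
    refine Finset.disjoint_left.2 fun v h1 h2 => ?_
    refine Finset.disjoint_left.1 (hb.pairwiseDisjoint hT1 hT2 fun h => hne (by rw [h]))
      (Finset.mem_toLeft.1 h1) (Finset.mem_toLeft.1 h2)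
  · intro T' hT'
    obtain ⟨T, hT1, rfl⟩ := Finset.mem_image.1 hT'
    refine Finset.disjoint_left.2 fun v h1 h2 => ?_
    exact Finset.disjoint_left.1 (hb.disjoint T hT1) (Finset.mem_toLeft.1 h1)
      (Finset.mem_toLeft.1 h2)
  · intro T' hT' v hv w hvw
    obtain ⟨T, hT1, rfl⟩ := Finset.mem_image.1 hT'
    simpa using hb.closed T hT1 _ (Finset.mem_toLeft.1 hv) (.inl w) (joinTop_adj_inl.2 hvw)

end Tutte




/-! ### Edge counts at odd sets in regular triangle-free graphs -/

section Boundary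

variable {V : Type*} [Fintype V] [DecidableEq V] {G : SimpleGraph V} [DecidableRel G.Adj]

theorem CliqueFree.exists_sum_card_neighborFinset_inter (hG : G.CliqueFree 3) (T : Finset V)
    (hT : Odd #T) :
    ∃ m, ∑ v ∈ T, #(G.neighborFinset v ∩ T) = 2 * m ∧ 4 * m + 1 ≤ #T ^ 2 := by
  let H := G.induce (T : Set V)
  have hH : H.CliqueFree (2 + 1) := hG.comap (Embedding.induce _).isContained
  refine ⟨#H.edgeFinset, ?_, ?_⟩
  · rw [← sum_degrees_eq_twice_card_edges, ← Finset.sum_coe_sort]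
    refine Finset.sum_congr rfl fun v _ => ?_
    rw [← card_neighborFinset_eq_degree,
      ← Finset.card_map (Function.Embedding.subtype (· ∈ (T : Set V)))]
    congr 1
    ext w
    simp [H, and_comm]
  · have h := hH.card_edgeFinset_le
    have hc : Fintype.card (T : Set V) = #T := by simp
    simp only [hc, Nat.odd_iff.1 hT] at h
    have : 1 ≤ #T ^ 2 := Nat.one_le_pow _ _ hT.pos
    norm_num at h
    omega

theorem IsRegularOfDegree.boundary_or_card {r : ℕ} (hreg : G.IsRegularOfDegree r)
    (hG : G.CliqueFree 3) {T : Finset V} (hT : Odd #T) :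
    (r ≤ ∑ v ∈ T, #(G.neighborFinset v \ T)) ∨
      (2 * r + 1 ≤ #T ∧ (Odd r → 1 ≤ ∑ v ∈ T, #(G.neighborFinset v \ T))) := by
  obtain ⟨m, hm, hle⟩ := hG.exists_sum_card_neighborFinset_inter T hT
  set e := ∑ v ∈ T, #(G.neighborFinset v \ T) with he
  have hsum : 2 * m + e = #T * r := by
    rw [← hm, he, ← Finset.sum_add_distrib, ← smul_eq_mul, ← Finset.sum_const]
    refine Finset.sum_congr rfl fun v _ => ?_
    rw [Finset.card_inter_add_card_sdiff, card_neighborFinset_eq_degree, hreg v]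
  by_cases hre : r ≤ e
  · exact .inl hre
  right
  obtain ⟨k, hk⟩ := hT
  rw [hk] at hsum hle ⊢
  constructor
  · by_contra! hlt
    -- Mantel gives `m ≤ k(k+1) ≤ kr`, so `e = (2k+1)r - 2m ≥ r`, a contradiction.
    have hkr : k + 1 ≤ r := by omega
    have h1 : 2 * k * r < 2 * k * (k + 1) := by nlinarith
    nlinarith
  · intro hodd
    have : Odd (2 * m + e) := by rw [hsum]; exact (odd_two_mul_add_one k).mul hodd
    rw [Nat.odd_iff] at this
    omega

theorem IsOddBarrier.sum_boundary_le {r : ℕ} (hreg : G.IsRegularOfDegree r) {S : Finset V}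
    {𝒯 : Finset (Finset V)} (hb : G.IsOddBarrier S 𝒯) :
    ∑ T ∈ 𝒯, ∑ v ∈ T, #(G.neighborFinset v \ T) ≤ #S * r := by
  calc ∑ T ∈ 𝒯, ∑ v ∈ T, #(G.neighborFinset v \ T)
      ≤ ∑ T ∈ 𝒯, ∑ v ∈ T, #(S.bipartiteAbove G.Adj v) := by
        refine Finset.sum_le_sum fun T hT => Finset.sum_le_sum fun v hv => Finset.card_le_card ?_
        intro w hw
        simp only [Finset.mem_sdiff, mem_neighborFinset] at hw
        exact Finset.mem_filter.2 ⟨(hb.closed T hT v hv w hw.1).resolve_left hw.2, hw.1⟩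
    _ = ∑ v ∈ 𝒯.biUnion id, #(S.bipartiteAbove G.Adj v) := by
        rw [Finset.sum_biUnion hb.pairwiseDisjoint]; rfl
    _ = ∑ s ∈ S, #((𝒯.biUnion id).bipartiteBelow G.Adj s) :=
        Finset.sum_card_bipartiteAbove_eq_sum_card_bipartiteBelow _
    _ ≤ ∑ s ∈ S, r := by
        refine Finset.sum_le_sum fun s _ => ?_
        rw [← hreg s, ← card_neighborFinset_eq_degree]
        refine Finset.card_le_card fun w hw => ?_
        simpa using (Finset.mem_filter.1 hw).2.symm
    _ = #S * r := by simp

/-- Each `T` has boundary plus `a * r * #T` at least `r`; `hr1` is this bound for a large `T`, whose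
boundary is nonzero when `r` is odd. Summing over `𝒯` and dividing by `r` gives the claim. -/
theorem IsOddBarrier.card_le {r : ℕ} (hr : 0 < r) (hreg : G.IsRegularOfDegree r)
    (hG : G.CliqueFree 3) {a : ℝ} (ha : 0 ≤ a)
    (hr1 : (r : ℝ) ≤ (if Odd r then 1 else 0) + a * r * (2 * r + 1))
    {S : Finset V} {𝒯 : Finset (Finset V)} (hb : G.IsOddBarrier S 𝒯) :
    (#𝒯 : ℝ) ≤ #S + a * Fintype.card V := by
  have hrpos : (0 : ℝ) < r := by exact_mod_cast hr
  have hT : ∀ T ∈ 𝒯, (r : ℝ) ≤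
      ((∑ v ∈ T, #(G.neighborFinset v \ T) : ℕ) : ℝ) + a * r * #T := by
    intro T hT
    have hor := hreg.boundary_or_card hG (hb.odd T hT)
    generalize ∑ v ∈ T, #(G.neighborFinset v \ T) = e at hor ⊢
    rcases hor with h | ⟨h, ho⟩
    · have : (r : ℝ) ≤ e := Nat.cast_le.2 h
      have : 0 ≤ a * r * #T := by positivity
      linarith
    · refine hr1.trans (add_le_add ?_ ?_)
      · split_ifs with hodd
        · exact Nat.one_le_cast.2 (ho hodd)
        · exact Nat.cast_nonneg _
      · gcongr
        exact_mod_cast h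
  have h1 := Finset.sum_le_sum hT
  rw [Finset.sum_add_distrib, ← Finset.mul_sum, Finset.sum_const, nsmul_eq_mul] at h1
  have h2 : ((∑ T ∈ 𝒯, ∑ v ∈ T, #(G.neighborFinset v \ T) : ℕ) : ℝ) ≤ #S * r := by
    exact_mod_cast hb.sum_boundary_le hreg
  have h3 : ((∑ T ∈ 𝒯, #T : ℕ) : ℝ) ≤ Fintype.card V := by
    have : ∑ T ∈ 𝒯, #T = #(𝒯.biUnion id) := (Finset.card_biUnion hb.pairwiseDisjoint).symm
    rw [this]
    exact_mod_cast Finset.card_le_univ _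
  have h4 : a * r * ((∑ T ∈ 𝒯, #T : ℕ) : ℝ) ≤ a * r * Fintype.card V := by gcongr
  rw [Nat.cast_sum] at h2 h4
  refine le_of_mul_le_mul_right ?_ hrpos
  linarith

/-- A triangle-free regular graph has a matching leaving at most an `a`-fraction of the vertices
uncovered. -/
theorem IsRegularOfDegree.exists_isMatching {r : ℕ} (hr : 0 < r) (hreg : G.IsRegularOfDegree r)
    (hG : G.CliqueFree 3) {a : ℝ} (ha : 0 ≤ a)
    (hr1 : (r : ℝ) ≤ (if Odd r then 1 else 0) + a * r * (2 * r + 1)) :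
    ∃ M : G.Subgraph, M.IsMatching ∧
      (1 - a) / 2 * Fintype.card V ≤ (M.edgeSet.ncard : ℝ) := by
  set n := Fintype.card V with hn
  have hcard : ∀ S 𝒯, G.IsOddBarrier S 𝒯 → (#𝒯 : ℝ) ≤ #S + a * n :=
    fun S 𝒯 hb => hb.card_le hr hreg hG ha hr1
  -- `d` is the largest integer up to `a * n` with the parity of `n`.
  obtain ⟨d, heven, hd, hd2⟩ : ∃ d : ℕ, Even (n + d) ∧ (d : ℝ) ≤ a * n ∧ a * n < d + 2 := by
    have h0 : 0 ≤ a * n := by positivity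
    have h1 := Nat.floor_le h0
    have h2 := Nat.lt_floor_add_one (a * n)
    by_cases hp : Even (n + ⌊a * n⌋₊)
    · exact ⟨_, hp, h1, by linarith⟩
    have hpos : 1 ≤ ⌊a * n⌋₊ := by
      by_contra! hlt
      have hodd : Odd n := by
        rw [Nat.not_even_iff_odd, Nat.odd_iff] at hp
        rw [Nat.odd_iff]; omega
      -- For odd `n`, the whole vertex set is a barrier with `S = ∅`, forcing `1 ≤ a * n`.
      have := hcard ∅ {Finset.univ} ⟨by simpa [← hn] using hodd, by simp, by simp, by simp⟩
      simp only [Finset.card_singleton, Finset.card_empty, Nat.cast_one, Nat.cast_zero,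
        zero_add] at this
      exact absurd (Nat.le_floor (by exact_mod_cast this)) (not_le.2 hlt)
    obtain ⟨k, hk⟩ := Nat.exists_eq_add_of_le' hpos
    refine ⟨k, ?_, ?_, ?_⟩
    · rw [Nat.not_even_iff_odd, Nat.odd_iff] at hp
      rw [Nat.even_iff]; omega
    · rw [hk] at h1; push_cast at h1; linarith
    · rw [hk] at h2; push_cast at h2; linarith
  obtain ⟨M, hM, hle⟩ := exists_isMatching_of_card_lt (G := G) heven fun S 𝒯 hb => by
    have := hcard S 𝒯 hb
    have : (#𝒯 : ℝ) < ((#S + d + 2 : ℕ) : ℝ) := by push_cast; linarith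
    exact_mod_cast this
  refine ⟨M, hM, ?_⟩
  have : (n : ℝ) ≤ 2 * M.edgeSet.ncard + d := by exact_mod_cast hle
  linarith

end Boundary

theorem cliqueFree_three_of_le_egirth {V : Type*} {G : SimpleGraph V} (h : 4 ≤ G.egirth) :
    G.CliqueFree 3 := by
  intro s hs
  obtain ⟨u, w, hw, hl⟩ := is3Clique_iff_exists_cycle_length_three.1 ⟨s, hs⟩
  have := h.trans (egirth_le_length hw)
  rw [hl] at this
  norm_num at this

end SimpleGraph

/-! ### The numerical inequality for `a` -/

theorem succ_sq_le_two_pow {m : ℕ} (hm : 6 ≤ m) : (m + 1) ^ 2 ≤ 2 ^ m := by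
  induction m, hm using Nat.le_induction with
  | base => norm_num
  | succ k hk ih => rw [pow_succ 2 k]; nlinarith

/-- With `m = r - 2` this says `(r-1)^(r/(r-2)) ≤ 2r+1`. It fails at `m = 1`. -/
theorem succ_pow_add_two_le {m : ℕ} (hm : 2 ≤ m) : (m + 1) ^ (m + 2) ≤ (2 * m + 5) ^ m := by
  rcases lt_or_ge m 6 with h | h
  · interval_cases m <;> norm_num
  calc (m + 1) ^ (m + 2) = (m + 1) ^ m * (m + 1) ^ 2 := pow_add _ _ _
    _ ≤ (m + 1) ^ m * 2 ^ m := Nat.mul_le_mul_left _ (succ_sq_le_two_pow h)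
    _ = ((m + 1) * 2) ^ m := (mul_pow _ _ _).symm
    _ ≤ (2 * m + 5) ^ m := Nat.pow_le_pow_left (by omega) _

theorem le_parity_add_rpow_mul {r : ℕ} (hr : 3 ≤ r) :
    (r : ℝ) ≤ (if Odd r then 1 else 0) +
      ((r : ℝ) - 1) ^ (-((r : ℝ) / ((r : ℝ) - 2))) * r * (2 * r + 1) := by
  -- For `r = 3`, `a = 1/8` and the parity term is essential; for `r ≥ 4` it is not needed.
  rcases hr.eq_or_lt with rfl | hr4
  · have : ((3 : ℕ) : ℝ) - 1 = 2 := by norm_num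
    have h3 : -(((3 : ℕ) : ℝ) / (((3 : ℕ) : ℝ) - 2)) = ((-3 : ℤ) : ℝ) := by norm_num
    rw [this, h3, Real.rpow_intCast, if_pos (by decide)]
    norm_num
  obtain ⟨m, rfl⟩ := Nat.exists_eq_add_of_le' (show 2 ≤ r by omega)
  have hm : 2 ≤ m := by omega
  have hm0 : (0 : ℝ) < m := by exact_mod_cast (show 0 < m by omega)
  push_cast
  rw [show (m : ℝ) + 2 - 1 = m + 1 by ring, show (m : ℝ) + 2 - 2 = m by ring,
    Real.rpow_neg (by positivity)]
  have hx : ((m : ℝ) + 1) ^ (((m : ℝ) + 2) / m) ≤ 2 * m + 5 := by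
    rw [← Real.rpow_le_rpow_iff (by positivity) (by positivity) hm0,
      ← Real.rpow_mul (by positivity), div_mul_cancel₀ _ hm0.ne', Real.rpow_natCast]
    have := succ_pow_add_two_le hm
    have h2 : ((m : ℝ) + 1) ^ (m + 2) ≤ (2 * m + 5) ^ m := by exact_mod_cast this
    rwa [← Real.rpow_natCast, Nat.cast_add, Nat.cast_ofNat] at h2
  have hpos : 0 < ((m : ℝ) + 1) ^ (((m : ℝ) + 2) / m) := by positivity
  have h1 : 1 ≤ (((m : ℝ) + 1) ^ (((m : ℝ) + 2) / m))⁻¹ * (2 * m + 5) := by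
    rw [inv_mul_eq_div, one_le_div hpos]; exact hx
  have h0 : (0 : ℝ) ≤ if Odd (m + 2) then 1 else 0 := by split_ifs <;> norm_num
  nlinarith

theorem mainTheorem9 (g r : ℕ) (hg : 4 ≤ g) (hr : 3 ≤ r)
    {V : Type*} [Fintype V] (G : SimpleGraph V) [DecidableRel G.Adj]
    (hreg : G.IsRegularOfDegree r) (hgirth : (g : ℕ∞) ≤ G.egirth) :
    ∃ M : G.Subgraph, M.IsMatching ∧
      ((1 - ((r : ℝ) - 1) ^ (-((r : ℝ) / ((r : ℝ) - 2)))) / 2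
          - (r : ℝ) * ((r : ℝ) - 1) ^ ((g - 2) / 2) / (Nat.factorial ((g - 2) / 2) : ℝ))
        * (Fintype.card V : ℝ) ≤ (M.edgeSet.ncard : ℝ) := by
  classical
  obtain ⟨M, hM, hle⟩ := hreg.exists_isMatching (by omega)
    (SimpleGraph.cliqueFree_three_of_le_egirth (le_trans (by exact_mod_cast hg) hgirth))
    (Real.rpow_nonneg (by have : (3 : ℝ) ≤ r := by exact_mod_cast hr
                          linarith) _) (le_parity_add_rpow_mul hr)
  refine ⟨M, hM, le_trans (mul_le_mul_of_nonneg_right ?_ (Nat.cast_nonneg _)) hle⟩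
  have hr' : (0 : ℝ) ≤ (r : ℝ) - 1 := by
    have : (3 : ℝ) ≤ r := by exact_mod_cast hr
    linarith
  -- The subtracted factorial term is nonnegative.
  exact sub_le_self _ (by positivity)
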